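/- For a Hausdorff space $X$, let $R(X)$ be the Boolean algebra of regular closed subsets of $X$ (sets $A$ with $A=\operatorname{cl}\operatorname{int}A$; the order is inclusion and the meet is $A\wedge B=\operatorname{cl}\operatorname{int}(A\cap B)$), and let $\theta X$ be the set of ultrafilters of $R(X)$ with the topology whose base consists of the sets $\lambda(A)=\{\mathscr U\in\theta X: A\in\mathscr U\}$, $A\in R(X)$. Let $EX=\{\mathscr U\in\theta X:\bigcap\mathscr U\neq\emptyset\}$ be the Iliadis absolute of $X$, a subspace of $\theta X$, and let $k_X:EX\to X$ be the map with $k_X(\mathscr U)\in\bigcap\mathscr U$. Given a choice of a point $\mathscr U_x\in k_X^{-1}\{x\}$ for each $x\in X$, let $sX=\{\mathscr U_x:x\in X\}$, a subspace of $EX$. For a space $Y$, a free open ultrafilter on $Y$ is a maximal proper filter $\mathscr U$ of open subsets of $Y$ such that $\bigcap\{\operatorname{cl}_Y U:U\in\mathscr U\}=\emptyset$. The Katětov extension $\kappa Y$ is the union of $Y$ and the set of all free open ultrafilters on $Y$, with the topology whose base consists of the open subsets of $Y$ and the sets $U\cup\{\mathscr U\}$, where $\mathscr U$ is a free open ultrafilter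 on $Y$ and $U\in\mathscr U$. A space $X$ is selectively highly divergent (SHD) if for every sequence $(U_n)_{n<\omega}$ of nonempty open subsets of $X$ there are points $x_n\in U_n$ such that $(x_n)$ has no convergent subsequence; $X$ is semiregular if its regular open sets form a base; $X$ is extremally disconnected if the closure of every open set is open. **Theorem.** Choices of points $\mathscr U_x\in k_{\mathbb Q}^{-1}\{x\}$ ($x\in\mathbb Q$) exist. For each such choice, with $s\mathbb Q=\{\mathscr U_x:x\in\mathbb Q\}$, there is a sequence $(\mathscr V_n)_{n<\omega}$ of free open ultrafilters on $s\mathbb Q$ such that every nonempty open subset of $s\mathbb Q$ belongs to some $\mathscr V_n$; and for every such sequence the subspace $$\mathbb Q_*=s\mathbb Q\cup\{\mathscr V_n:n<\omega\}$$ of $\kappa(s\mathbb Q)$ is Hausdorff, extremally disconnected, has no isolated points and is not semiregular. In particular, $\mathbb Q_*$ is a countable SHD space that is not semiregular. -/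

import Mathlib

open Set Filter Topology

/-- A space is selectively highly divergent (SHD) if from every sequence of nonempty open sets one
can select points forming a sequence without convergent subsequences. -/
def IsSHD (X : Type*) [TopologicalSpace X] : Prop :=
  ∀ U : ℕ → Set X, (∀ n, IsOpen (U n) ∧ (U n).Nonempty) →
    ∃ x : ℕ → X, (∀ n, x n ∈ U n) ∧
      ∀ φ : ℕ → ℕ, StrictMono φ → ∀ a : X, ¬ Tendsto (x ∘ φ) atTop (𝓝 a)

/-- A space is semiregular if its regular open sets form a base. -/
def IsSemiregular (X : Type*) [TopologicalSpace X] : Prop :=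
  TopologicalSpace.IsTopologicalBasis {U : Set X | interior (closure U) = U}

/-- Regular closed sets, the elements of the Boolean algebra `R(X)`. -/
def IsRegClosed {X : Type*} [TopologicalSpace X] (A : Set X) : Prop :=
  closure (interior A) = A

/-- Proper filters in the Boolean algebra `R(X)`, whose order is inclusion and whose meet is
`A ∧ B = cl (int (A ∩ B))`. -/
structure IsRegClosedFilter {X : Type*} [TopologicalSpace X] (F : Set (Set X)) : Prop where
  regClosed : ∀ A ∈ F, IsRegClosed A
  univ_mem : univ ∈ F
  empty_notMem : ∅ ∉ F
  meet_mem : ∀ A ∈ F, ∀ B ∈ F, closure (interior (A ∩ B)) ∈ F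
  mem_of_subset : ∀ A ∈ F, ∀ B, IsRegClosed B → A ⊆ B → B ∈ F

/-- The set `θX` of all `R(X)`-ultrafilters, i.e. maximal proper filters in `R(X)`. -/
def ThetaSpace (X : Type*) [TopologicalSpace X] : Type _ :=
  {F : Set (Set X) // Maximal IsRegClosedFilter F}

/-- `λ(A)`, the set of all `R(X)`-ultrafilters that contain `A`. -/
def thetaBasic {X : Type*} [TopologicalSpace X] (A : Set X) : Set (ThetaSpace X) :=
  {F | A ∈ F.1}

instance (X : Type*) [TopologicalSpace X] : TopologicalSpace (ThetaSpace X) :=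
  TopologicalSpace.generateFrom {S | ∃ A : Set X, IsRegClosed A ∧ S = thetaBasic A}

/-- The Iliadis absolute `EX`, a subspace of `θX`. -/
abbrev IliadisAbsolute (X : Type*) [TopologicalSpace X] : Type _ :=
  {F : ThetaSpace X // (⋂₀ F.1).Nonempty}

/-- The map `k_X : EX → X` with `k_X(F) ∈ ⋂ F`; for Hausdorff `X` this point is unique. -/
noncomputable def iliadisMap (X : Type*) [TopologicalSpace X] (F : IliadisAbsolute X) : X :=
  F.2.some

/-- A choice of one point `u x` in each fibre of `k_X`. -/
def IsFibreSelection {X : Type*} [TopologicalSpace X] (u : X → IliadisAbsolute X) : Prop :=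
  ∀ x, iliadisMap X (u x) = x

/-- The space `sX = {u x : x ∈ X}`, a subspace of `EX`. -/
abbrev SSpace {X : Type*} [TopologicalSpace X] (u : X → IliadisAbsolute X) : Type _ :=
  ↥(Set.range u)

/-- Proper filters in the lattice of open sets. -/
structure IsOpenFilter {Y : Type*} [TopologicalSpace Y] (F : Set (Set Y)) : Prop where
  isOpen : ∀ U ∈ F, IsOpen U
  univ_mem : univ ∈ F
  empty_notMem : ∅ ∉ F
  inter_mem : ∀ U ∈ F, ∀ V ∈ F, U ∩ V ∈ F
  mem_of_subset : ∀ U ∈ F, ∀ V, IsOpen V → U ⊆ V → V ∈ F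

/-- Free open ultrafilters: maximal proper open filters with empty adherence. -/
structure FreeOpenUltrafilter (Y : Type*) [TopologicalSpace Y] where
  sets : Set (Set Y)
  maximal : Maximal IsOpenFilter sets
  free : (⋂ U ∈ sets, closure U) = ∅

/-- The underlying set of the Katětov extension `κY`: the points of `Y` together with the free open
ultrafilters on `Y`. -/
inductive KatetovExtension (Y : Type*) [TopologicalSpace Y] where
  | pt (y : Y) : KatetovExtension Y
  | ultra (F : FreeOpenUltrafilter Y) : KatetovExtension Y

/-- The topology of `κY`, with base the open sets of `Y` and the sets `U ∪ {F}` with `U ∈ F`. -/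
instance (Y : Type*) [TopologicalSpace Y] : TopologicalSpace (KatetovExtension Y) :=
  TopologicalSpace.generateFrom
    ({S | ∃ U : Set Y, IsOpen U ∧ S = KatetovExtension.pt '' U} ∪
     {S | ∃ (F : FreeOpenUltrafilter Y) (U : Set Y), U ∈ F.sets ∧
        S = KatetovExtension.pt '' U ∪ {KatetovExtension.ultra F}})

/-- Every nonempty open set belongs to some member of the sequence `V` of free open
ultrafilters. -/
def IsOpenCovering {Y : Type*} [TopologicalSpace Y] (V : ℕ → FreeOpenUltrafilter Y) : Prop :=
  ∀ U : Set Y, IsOpen U → U.Nonempty → ∃ n, U ∈ (V n).sets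

/-- The subspace `Y ∪ {V n : n < ω}` of `κY`. -/
abbrev StarSpace {Y : Type*} [TopologicalSpace Y] (V : ℕ → FreeOpenUltrafilter Y) : Type _ :=
  ↥(Set.range (KatetovExtension.pt (Y := Y)) ∪ Set.range fun n => KatetovExtension.ultra (V n))

/-! The restriction of `k_X` to `sX` is a continuous bijection onto `X` when `X` is regular
Hausdorff, and preimages of nonempty open sets form a π-base. So `sℚ` is countable, Hausdorff and
without isolated points. It is also extremally disconnected: traces of the sets `λ(A)` form a clopen
base, and `R(X)` has the joins needed to write the closure of an open set as one such trace.

Each irrational is a hole of `sℚ` over which a free open ultrafilter sits. One hole in every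
rational interval yields a covering sequence `V`.

In `ℚ_*` the space `sℚ` is open and dense, and `V n` adheres to an open `U ⊆ sℚ` exactly when `U ∈ V
n`. This transfers extremal disconnectedness (`StarSpace.extremallyDisconnected`). Semiregularity
fails because a nonempty open `W ⊆ sℚ` belongs to some `V n`, which puts `V n` into `int cl W`;
hence `W` is not regular open (`StarSpace.not_isSemiregular`).

SHD follows from Hausdorff, extremally disconnected and no isolated points: open sets are infinite,
so distinct points can be selected, and an injective sequence never converges
(`not_tendsto_of_injective`). -/

/-! ### Ultrafilters of regular closed sets and fibres of `k_X`. -/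

section RegClosed

variable {X : Type*} [TopologicalSpace X]

theorem IsOpen.isRegClosed_closure {U : Set X} (hU : IsOpen U) : IsRegClosed (closure U) :=
  subset_antisymm (closure_minimal interior_subset isClosed_closure)
    (closure_mono (hU.subset_interior_closure))

theorem IsRegClosed.isClosed {A : Set X} (hA : IsRegClosed A) : IsClosed A := by
  rw [← hA]; exact isClosed_closure

theorem closure_interior_inter_subset {A B : Set X} (hA : IsClosed A) (hB : IsClosed B) :
    closure (interior (A ∩ B)) ⊆ A ∩ B :=
  closure_minimal interior_subset (hA.inter hB)

theorem IsRegClosedFilter.nonempty_interior_inter {F : Set (Set X)} (hF : IsRegClosedFilter F)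
    {A B : Set X} (hA : A ∈ F) (hB : B ∈ F) : (interior (A ∩ B)).Nonempty := by
  by_contra h
  rw [not_nonempty_iff_eq_empty] at h
  have := hF.meet_mem A hA B hB
  rw [h, closure_empty] at this
  exact hF.empty_notMem this

/-- A regular closed set compatible with every member of an ultrafilter belongs to it. -/
theorem mem_of_maximal_isRegClosedFilter {F : Set (Set X)} (hF : Maximal IsRegClosedFilter F)
    {A : Set X} (hA : IsRegClosed A) (h : ∀ B ∈ F, (interior (A ∩ B)).Nonempty) : A ∈ F := by
  have hreg := hF.prop.regClosed
  -- The filter generated by `F` and `A`; as `C` is closed, containing the interior amounts to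
  -- containing the meet.
  have key : IsRegClosedFilter {C | IsRegClosed C ∧ ∃ B ∈ F, interior (A ∩ B) ⊆ C} := by
    refine ⟨fun C hC => hC.1, ⟨by simp [IsRegClosed], univ, hF.prop.univ_mem, subset_univ _⟩,
      ?_, ?_, ?_⟩
    · rintro ⟨-, B, hB, hAB⟩
      exact (h B hB).ne_empty (subset_empty_iff.1 hAB)
    · rintro C ⟨hC, B, hB, hBC⟩ D ⟨hD, B', hB', hBD⟩
      refine ⟨isOpen_interior.isRegClosed_closure, _, hF.prop.meet_mem B hB B' hB', ?_⟩
      have hsub := closure_interior_inter_subset (hreg B hB).isClosed (hreg B' hB').isClosed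
      refine subset_trans (interior_maximal (subset_inter ?_ ?_) isOpen_interior) subset_closure
      · exact (interior_mono (inter_subset_inter_right A (hsub.trans inter_subset_left))).trans hBC
      · exact (interior_mono (inter_subset_inter_right A (hsub.trans inter_subset_right))).trans hBD
    · rintro C ⟨-, B, hB, hBC⟩ D hD hCD
      exact ⟨hD, B, hB, hBC.trans hCD⟩
  refine hF.le_of_ge key ?_ ⟨hA, univ, hF.prop.univ_mem, ?_⟩
  · exact fun B hB => ⟨hreg B hB, B, hB, interior_subset.trans inter_subset_right⟩
  · exact interior_subset.trans inter_subset_left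

/-- `closure Aᶜ` is the Boolean complement of `A` in `R(X)`: some `B ∈ F` has zero meet with `A`, so
`B` lies below that complement. -/
theorem closure_compl_mem_of_notMem {F : Set (Set X)} (hF : Maximal IsRegClosedFilter F)
    {A : Set X} (hA : IsRegClosed A) (h : A ∉ F) : closure Aᶜ ∈ F := by
  obtain ⟨B, hB, hAB⟩ : ∃ B ∈ F, ¬ (interior (A ∩ B)).Nonempty := by
    by_contra! hcon
    exact h (mem_of_maximal_isRegClosedFilter hF hA hcon)
  have hregB := hF.prop.regClosed B hB
  refine hF.prop.mem_of_subset B hB _ hA.isClosed.isOpen_compl.isRegClosed_closure ?_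
  rw [not_nonempty_iff_eq_empty, interior_inter] at hAB
  rw [← hregB]
  refine closure_minimal ?_ isClosed_closure
  rw [closure_compl, subset_compl_iff_disjoint_left, disjoint_iff_inter_eq_empty]
  exact hAB

theorem disjoint_interior_closure_compl (A : Set X) : interior (A ∩ closure Aᶜ) = ∅ := by
  rw [closure_compl, interior_inter, ← disjoint_iff_inter_eq_empty]
  exact disjoint_compl_right.mono_right interior_subset

theorem closure_compl_mem_iff {F : Set (Set X)} (hF : Maximal IsRegClosedFilter F)
    {A : Set X} (hA : IsRegClosed A) : closure Aᶜ ∈ F ↔ A ∉ F := by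
  refine ⟨fun h hAF => ?_, closure_compl_mem_of_notMem hF hA⟩
  exact (hF.prop.nonempty_interior_inter hAF h).ne_empty (disjoint_interior_closure_compl A)

theorem mem_of_mem_interior {F : Set (Set X)} (hF : Maximal IsRegClosedFilter F) {x : X}
    (hx : x ∈ ⋂₀ F) {A : Set X} (hA : IsRegClosed A) (hxA : x ∈ interior A) : A ∈ F := by
  by_contra h
  have := hx _ (closure_compl_mem_of_notMem hF hA h)
  rw [closure_compl] at this
  exact this hxA

theorem IsRegClosedFilter.exists_maximal {F : Set (Set X)} (hF : IsRegClosedFilter F) :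
    ∃ G, F ⊆ G ∧ Maximal IsRegClosedFilter G := by
  refine zorn_subset_nonempty {G | IsRegClosedFilter G} ?_ F hF
  intro c hc hchain ⟨G₀, hG₀⟩
  refine ⟨⋃₀ c, ⟨?_, ⟨G₀, hG₀, (hc hG₀).univ_mem⟩, ?_, ?_, ?_⟩, fun G => subset_sUnion_of_mem⟩
  · rintro A ⟨G, hG, hA⟩
    exact (hc hG).regClosed A hA
  · rintro ⟨G, hG, hA⟩
    exact (hc hG).empty_notMem hA
  · rintro A ⟨G, hG, hA⟩ B ⟨H, hH, hB⟩
    rcases hchain.total hG hH with h | h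
    · exact ⟨H, hH, (hc hH).meet_mem A (h hA) B hB⟩
    · exact ⟨G, hG, (hc hG).meet_mem A hA B (h hB)⟩
  · rintro A ⟨G, hG, hA⟩ B hB hAB
    exact ⟨G, hG, (hc hG).mem_of_subset A hA B hB hAB⟩

theorem isRegClosedFilter_nhds (x : X) :
    IsRegClosedFilter {A : Set X | IsRegClosed A ∧ x ∈ interior A} := by
  refine ⟨fun A hA => hA.1, by simp [IsRegClosed], by simp, ?_, ?_⟩
  · rintro A ⟨-, hA⟩ B ⟨-, hB⟩
    refine ⟨isOpen_interior.isRegClosed_closure, ?_⟩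
    apply isOpen_interior.subset_interior_closure
    rw [interior_inter]
    exact ⟨hA, hB⟩
  · rintro A ⟨-, hA⟩ B hB hAB
    exact ⟨hB, interior_mono hAB hA⟩

theorem iliadisMap_mem (F : IliadisAbsolute X) : iliadisMap X F ∈ ⋂₀ F.1.1 := F.2.some_mem

theorem iliadisMap_eq [T2Space X] (F : IliadisAbsolute X) {x : X} (hx : x ∈ ⋂₀ F.1.1) :
    iliadisMap X F = x := by
  by_contra hne
  obtain ⟨U, V, hU, hV, hxU, hyV, hUV⟩ := t2_separation hne
  have hmem : closure V ∈ F.1.1 := mem_of_mem_interior F.1.2 hx hV.isRegClosed_closure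
    (hV.subset_interior_closure hyV)
  exact (hUV.closure_right hU).le_bot ⟨hxU, iliadisMap_mem F _ hmem⟩

theorem exists_isFibreSelection (X : Type*) [TopologicalSpace X] [T2Space X] :
    ∃ u : X → IliadisAbsolute X, IsFibreSelection u := by
  have h (x : X) : ∃ F : IliadisAbsolute X, iliadisMap X F = x := by
    obtain ⟨G, hFG, hG⟩ := (isRegClosedFilter_nhds x).exists_maximal
    have hx : x ∈ ⋂₀ G := by
      intro A hA
      -- If `x ∉ A`, the complement `closure Aᶜ` is a neighbourhood of `x`, hence already in `G`.
      by_contra hxA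
      have hreg := hG.prop.regClosed A hA
      refine (closure_compl_mem_iff hG hreg).1 (hFG ⟨?_, ?_⟩) hA
      · exact hreg.isClosed.isOpen_compl.isRegClosed_closure
      · exact hreg.isClosed.isOpen_compl.subset_interior_closure hxA
    exact ⟨⟨⟨G, hG⟩, x, hx⟩, iliadisMap_eq _ hx⟩
  choose u hu using h
  exact ⟨u, hu⟩

theorem isTopologicalBasis_thetaBasic :
    TopologicalSpace.IsTopologicalBasis
      {S : Set (ThetaSpace X) | ∃ A : Set X, IsRegClosed A ∧ S = thetaBasic A} := by
  refine ⟨?_, ?_, rfl⟩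
  · rintro _ ⟨A, hA, rfl⟩ _ ⟨B, hB, rfl⟩ F ⟨hFA, hFB⟩
    have hsub := closure_interior_inter_subset hA.isClosed hB.isClosed
    refine ⟨_, ⟨_, isOpen_interior.isRegClosed_closure, rfl⟩, F.2.prop.meet_mem A hFA B hFB, ?_⟩
    exact fun G hG => ⟨G.2.prop.mem_of_subset _ hG A hA (hsub.trans inter_subset_left),
      G.2.prop.mem_of_subset _ hG B hB (hsub.trans inter_subset_right)⟩
  · refine eq_univ_of_forall fun F => ⟨thetaBasic univ, ⟨univ, by simp [IsRegClosed], rfl⟩, ?_⟩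
    exact F.2.prop.univ_mem

end RegClosed

/-! ### The space `sX`: clopen base, projection to `X`, extremal disconnectedness. -/

section SSpace

variable {X : Type*} [TopologicalSpace X]

/-- The trace on `sX` of the basic open set `λ(A)`. -/
def sBasic (u : X → IliadisAbsolute X) (A : Set X) : Set (SSpace u) :=
  {p | A ∈ p.1.1.1}

/-- The restriction of `k_X` to `sX`. -/
noncomputable def sProj (u : X → IliadisAbsolute X) (p : SSpace u) : X :=
  iliadisMap X p.1

variable {u : X → IliadisAbsolute X}

theorem isTopologicalBasis_sBasic :
    TopologicalSpace.IsTopologicalBasis {S | ∃ A : Set X, IsRegClosed A ∧ S = sBasic u A} := by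
  have h := (isTopologicalBasis_thetaBasic (X := X)).isInducing
    (Topology.IsInducing.subtypeVal.comp (Topology.IsInducing.subtypeVal (t := range u)))
  convert h using 1
  ext S
  constructor
  · rintro ⟨A, hA, rfl⟩
    exact ⟨_, ⟨A, hA, rfl⟩, rfl⟩
  · rintro ⟨_, ⟨A, hA, rfl⟩, rfl⟩
    exact ⟨A, hA, rfl⟩

theorem isOpen_sBasic {A : Set X} (hA : IsRegClosed A) : IsOpen (sBasic u A) :=
  isTopologicalBasis_sBasic.isOpen ⟨A, hA, rfl⟩

theorem isClosed_sBasic {A : Set X} (hA : IsRegClosed A) : IsClosed (sBasic u A) := by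
  have : (sBasic u A)ᶜ = sBasic u (closure Aᶜ) := by
    ext p
    exact (closure_compl_mem_iff p.1.1.2 hA).symm
  rw [← isOpen_compl_iff, this]
  exact isOpen_sBasic hA.isClosed.isOpen_compl.isRegClosed_closure

theorem sBasic_subset_preimage (A : Set X) : sBasic u A ⊆ sProj u ⁻¹' A :=
  fun p hp => iliadisMap_mem p.1 A hp

theorem preimage_interior_subset_sBasic {A : Set X} (hA : IsRegClosed A) :
    sProj u ⁻¹' interior A ⊆ sBasic u A :=
  fun p hp => mem_of_mem_interior p.1.1.2 (iliadisMap_mem p.1) hA hp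

/-- Regularity gives a regular closed neighbourhood of the image point inside `W`; its trace is a
neighbourhood of `p` lying over it. -/
theorem continuous_sProj [RegularSpace X] : Continuous (sProj u) := by
  refine continuous_def.2 fun W hW => isOpen_iff_mem_nhds.2 fun p hp => ?_
  obtain ⟨C, hC, hCc, hCW⟩ := exists_mem_nhds_isClosed_subset (hW.mem_nhds hp)
  have hreg : IsRegClosed (closure (interior C)) := isOpen_interior.isRegClosed_closure
  refine mem_of_superset ((isOpen_sBasic hreg).mem_nhds (preimage_interior_subset_sBasic hreg
    (isOpen_interior.subset_interior_closure (mem_interior_iff_mem_nhds.2 hC)))) ?_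
  exact (sBasic_subset_preimage _).trans (preimage_mono
    ((closure_minimal interior_subset hCc).trans hCW))

theorem sProj_injective (hu : IsFibreSelection u) : Function.Injective (sProj u) := by
  rintro ⟨_, x, rfl⟩ ⟨_, y, rfl⟩ h
  have : x = y := (hu x).symm.trans (h.trans (hu y))
  rw [this]

theorem sProj_surjective (hu : IsFibreSelection u) : Function.Surjective (sProj u) :=
  fun x => ⟨⟨u x, x, rfl⟩, hu x⟩

/-- The preimages of the nonempty open subsets of `X` form a `π`-base of `sX`. -/
theorem exists_preimage_sProj_subset {U : Set (SSpace u)} (hU : IsOpen U) (hne : U.Nonempty) :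
    ∃ W : Set X, IsOpen W ∧ W.Nonempty ∧ sProj u ⁻¹' W ⊆ U := by
  obtain ⟨p, hp⟩ := hne
  obtain ⟨_, ⟨A, hA, rfl⟩, hpA, hAU⟩ := isTopologicalBasis_sBasic.exists_subset_of_mem_open hp hU
  refine ⟨interior A, isOpen_interior, ?_, (preimage_interior_subset_sBasic hA).trans hAU⟩
  simpa using p.1.1.2.prop.nonempty_interior_inter hpA hpA

theorem extremallyDisconnected_sSpace (hu : IsFibreSelection u) :
    ExtremallyDisconnected (SSpace u) := by
  refine ⟨fun U hU => ?_⟩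
  -- `closure O` is the join in `R(X)` of all `C` whose trace lies in `U`.
  set O : Set X := ⋃ C ∈ {C : Set X | IsRegClosed C ∧ sBasic u C ⊆ U}, interior C with hO
  have hOo : IsOpen O := isOpen_biUnion fun _ _ => isOpen_interior
  have hreg := hOo.isRegClosed_closure
  suffices closure U = sBasic u (closure O) from this ▸ isOpen_sBasic hreg
  refine subset_antisymm (closure_minimal ?_ (isClosed_sBasic hreg)) ?_
  · intro p hp
    obtain ⟨_, ⟨A, hA, rfl⟩, hpA, hAU⟩ :=
      isTopologicalBasis_sBasic.exists_subset_of_mem_open hp hU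
    refine p.1.1.2.prop.mem_of_subset A hpA _ hreg ?_
    rw [← hA]
    exact closure_mono (subset_biUnion_of_mem (u := interior)
      (show A ∈ {C : Set X | IsRegClosed C ∧ sBasic u C ⊆ U} from ⟨hA, hAU⟩))
  · intro p hp
    rw [isTopologicalBasis_sBasic.mem_closure_iff]
    rintro _ ⟨C, hC, rfl⟩ hpC
    obtain ⟨x, hx⟩ := p.1.1.2.prop.nonempty_interior_inter hp hpC
    rw [interior_inter] at hx
    -- `interior C` meets `O`, hence some `interior A` with trace of `A` inside `U`; the point of
    -- `sX` over a common point lies in both traces.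
    obtain ⟨y, hyC, hyO⟩ := mem_closure_iff.1 (interior_subset hx.1) _ isOpen_interior hx.2
    rw [hO, mem_iUnion₂] at hyO
    obtain ⟨A, ⟨hA, hAU⟩, hyA⟩ := hyO
    obtain ⟨q, rfl⟩ := sProj_surjective hu y
    exact ⟨q, preimage_interior_subset_sBasic hC hyC,
      hAU (preimage_interior_subset_sBasic hA hyA)⟩

theorem not_isOpen_singleton_sSpace (hu : IsFibreSelection u)
    (hX : ∀ x : X, ¬ IsOpen ({x} : Set X)) (p : SSpace u) : ¬ IsOpen ({p} : Set (SSpace u)) := by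
  intro hp
  obtain ⟨W, hW, ⟨x, hx⟩, hWp⟩ := exists_preimage_sProj_subset hp (singleton_nonempty p)
  have hsub : W ⊆ {sProj u p} := by
    intro y hy
    obtain ⟨q, rfl⟩ := sProj_surjective hu y
    rw [hWp hy]
    rfl
  refine hX (sProj u p) ?_
  rwa [← (subset_singleton_iff_eq.1 hsub).resolve_left (Nonempty.ne_empty ⟨x, hx⟩)]

end SSpace

/-! ### Free open ultrafilters and the covering sequence on `sℚ`. -/

section OpenFilter

variable {Y : Type*} [TopologicalSpace Y]

theorem IsOpenFilter.exists_maximal {F : Set (Set Y)} (hF : IsOpenFilter F) :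
    ∃ G, F ⊆ G ∧ Maximal IsOpenFilter G := by
  refine zorn_subset_nonempty {G | IsOpenFilter G} ?_ F hF
  intro c hc hchain ⟨G₀, hG₀⟩
  refine ⟨⋃₀ c, ⟨?_, ⟨G₀, hG₀, (hc hG₀).univ_mem⟩, ?_, ?_, ?_⟩, fun G => subset_sUnion_of_mem⟩
  · rintro A ⟨G, hG, hA⟩
    exact (hc hG).isOpen A hA
  · rintro ⟨G, hG, hA⟩
    exact (hc hG).empty_notMem hA
  · rintro A ⟨G, hG, hA⟩ B ⟨H, hH, hB⟩
    rcases hchain.total hG hH with h | h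
    · exact ⟨H, hH, (hc hH).inter_mem A (h hA) B hB⟩
    · exact ⟨G, hG, (hc hG).inter_mem A hA B (h hB)⟩
  · rintro A ⟨G, hG, hA⟩ B hB hAB
    exact ⟨G, hG, (hc hG).mem_of_subset A hA B hB hAB⟩

namespace FreeOpenUltrafilter

variable (F : FreeOpenUltrafilter Y)

theorem nonempty_of_mem {U : Set Y} (hU : U ∈ F.sets) : U.Nonempty :=
  nonempty_iff_ne_empty.2 fun h => F.maximal.prop.empty_notMem (h ▸ hU)

theorem mem_of_forall_inter_nonempty {U : Set Y} (hU : IsOpen U)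
    (h : ∀ W ∈ F.sets, (U ∩ W).Nonempty) : U ∈ F.sets := by
  have hF := F.maximal.prop
  have key : IsOpenFilter {C | IsOpen C ∧ ∃ B ∈ F.sets, U ∩ B ⊆ C} := by
    refine ⟨fun C hC => hC.1, ⟨isOpen_univ, univ, hF.univ_mem, subset_univ _⟩, ?_, ?_, ?_⟩
    · rintro ⟨-, B, hB, hUB⟩
      exact (h B hB).ne_empty (subset_empty_iff.1 hUB)
    · rintro C ⟨hC, B, hB, hBC⟩ D ⟨hD, B', hB', hBD⟩
      exact ⟨hC.inter hD, _, hF.inter_mem B hB B' hB',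
        fun x hx => ⟨hBC ⟨hx.1, hx.2.1⟩, hBD ⟨hx.1, hx.2.2⟩⟩⟩
    · rintro C ⟨-, B, hB, hBC⟩ D hD hCD
      exact ⟨hD, B, hB, hBC.trans hCD⟩
  refine F.maximal.le_of_ge key ?_ ⟨hU, univ, hF.univ_mem, inter_subset_left⟩
  exact fun B hB => ⟨hF.isOpen B hB, B, hB, inter_subset_right⟩

theorem ext_sets {F G : FreeOpenUltrafilter Y} (h : F.sets = G.sets) : F = G := by
  cases F; cases G; cases h; rfl

theorem exists_disjoint_of_ne {F G : FreeOpenUltrafilter Y} (h : F ≠ G) :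
    ∃ U ∈ F.sets, ∃ W ∈ G.sets, Disjoint U W := by
  by_contra! hcon
  refine h (ext_sets (F.maximal.eq_of_subset G.maximal.prop fun U hU => ?_))
  refine G.mem_of_forall_inter_nonempty (F.maximal.prop.isOpen U hU) fun W hW => ?_
  exact not_disjoint_iff_nonempty_inter.1 (hcon U hU W hW)

theorem exists_notMem_closure (y : Y) : ∃ U ∈ F.sets, y ∉ closure U := by
  have hy : y ∉ ⋂ U ∈ F.sets, closure U := by simp [F.free]
  simpa using hy

end FreeOpenUltrafilter

/-- Over every point of `Z` outside the range of a continuous map `f : Y → Z` that is a limit of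
that range there is a free open ultrafilter on `Y`. -/
theorem exists_freeOpenUltrafilter_comap {Z : Type*} [TopologicalSpace Z] [T2Space Z] {f : Y → Z}
    (hf : Continuous f) {z : Z} (hz : z ∉ range f) (hzc : z ∈ closure (range f)) :
    ∃ F : FreeOpenUltrafilter Y, ∀ W, IsOpen W → z ∈ W → f ⁻¹' W ∈ F.sets := by
  have hfil : IsOpenFilter {U : Set Y | IsOpen U ∧ ∃ W, IsOpen W ∧ z ∈ W ∧ f ⁻¹' W ⊆ U} := by
    refine ⟨fun U hU => hU.1, ⟨isOpen_univ, univ, isOpen_univ, mem_univ _, subset_univ _⟩,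
      ?_, ?_, ?_⟩
    · rintro ⟨-, W, hW, hzW, hsub⟩
      obtain ⟨_, hw, y, rfl⟩ := mem_closure_iff.1 hzc W hW hzW
      exact hsub hw
    · rintro U ⟨hU, W, hW, hzW, hsub⟩ U' ⟨hU', W', hW', hzW', hsub'⟩
      exact ⟨hU.inter hU', W ∩ W', hW.inter hW', ⟨hzW, hzW'⟩,
        fun y hy => ⟨hsub hy.1, hsub' hy.2⟩⟩
    · rintro U ⟨-, W, hW, hzW, hsub⟩ U' hU' hUU'
      exact ⟨hU', W, hW, hzW, hsub.trans hUU'⟩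
  obtain ⟨G, hFG, hG⟩ := hfil.exists_maximal
  have hmem (W : Set Z) (hW : IsOpen W) (hzW : z ∈ W) : f ⁻¹' W ∈ G :=
    hFG ⟨hW.preimage hf, W, hW, hzW, subset_rfl⟩
  refine ⟨⟨G, hG, ?_⟩, hmem⟩
  refine eq_empty_of_forall_notMem fun y hy => ?_
  obtain ⟨A, B, hA, hB, hyA, hzB, hAB⟩ := t2_separation (show f y ≠ z from fun h => hz ⟨y, h⟩)
  have hcl := mem_iInter₂.1 hy _ (hmem B hB hzB)
  exact (hAB.closure_right hA).le_bot ⟨hyA, hf.closure_preimage_subset B hcl⟩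

theorem exists_isOpenCovering {u : ℚ → IliadisAbsolute ℚ} (hu : IsFibreSelection u) :
    ∃ V : ℕ → FreeOpenUltrafilter (SSpace u), IsOpenCovering V := by
  have hcont : Continuous fun p : SSpace u => ((sProj u p : ℚ) : ℝ) :=
    Rat.continuous_coe_real.comp continuous_sProj
  have hrange : range (fun p : SSpace u => ((sProj u p : ℚ) : ℝ)) = range ((↑) : ℚ → ℝ) :=
    (sProj_surjective hu).range_comp _
  have hex (a : ℚ × ℚ) : ∃ F : FreeOpenUltrafilter (SSpace u),
      a.1 < a.2 → sProj u ⁻¹' Ioo a.1 a.2 ∈ F.sets := by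
    have aux {a b : ℚ} (h : a < b) :
        ∃ F : FreeOpenUltrafilter (SSpace u), sProj u ⁻¹' Ioo a b ∈ F.sets := by
      obtain ⟨r, hr, har, hrb⟩ := exists_irrational_btwn (Rat.cast_lt (K := ℝ).2 h)
      obtain ⟨F, hF⟩ := exists_freeOpenUltrafilter_comap hcont (z := r)
        (by rw [hrange]; exact hr)
        (by rw [hrange]; exact Rat.denseRange_cast r)
      refine ⟨F, ?_⟩
      convert hF (Ioo (a : ℝ) b) isOpen_Ioo ⟨har, hrb⟩ using 1
      ext p
      simp
    by_cases h : a.1 < a.2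
    · obtain ⟨F, hF⟩ := aux h
      exact ⟨F, fun _ => hF⟩
    -- For an empty interval any ultrafilter serves; the one from `(0, 1)` is a default.
    · obtain ⟨F, -⟩ := aux (zero_lt_one (α := ℚ))
      exact ⟨F, fun h' => absurd h' h⟩
  choose F hF using hex
  obtain ⟨e, he⟩ := exists_surjective_nat (ℚ × ℚ)
  refine ⟨F ∘ e, fun U hU hne => ?_⟩
  obtain ⟨W, hW, ⟨x, hx⟩, hWU⟩ := exists_preimage_sProj_subset hU hne
  obtain ⟨a, b, ⟨hax, hxb⟩, hab⟩ := mem_nhds_iff_exists_Ioo_subset.1 (hW.mem_nhds hx)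
  obtain ⟨n, hn⟩ := he (a, b)
  refine ⟨n, ?_⟩
  rw [Function.comp_apply, hn]
  exact (F (a, b)).maximal.prop.mem_of_subset _ (hF (a, b) (hax.trans hxb)) U hU
    ((preimage_mono hab).trans hWU)

end OpenFilter

/-! ### Topology of the Katětov extension and of `Y ∪ {V n}`. -/

section Star

variable {Y : Type*} [TopologicalSpace Y]

/-- A basic neighbourhood of an ultrafilter contains no other ultrafilter, so openness is decided by
the trace on `Y` alone. -/
theorem KatetovExtension.isOpen_iff {O : Set (KatetovExtension Y)} :
    IsOpen O ↔ IsOpen (pt ⁻¹' O) ∧ ∀ F, ultra F ∈ O → pt ⁻¹' O ∈ F.sets := by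
  have hinj : Function.Injective (pt (Y := Y)) := fun a b h => by cases h; rfl
  constructor
  · intro h
    induction h with
    | basic S hS =>
      rcases hS with ⟨U, hU, rfl⟩ | ⟨F, U, hU, rfl⟩
      · rw [hinj.preimage_image]
        exact ⟨hU, fun F hF => by simp at hF⟩
      · have : pt ⁻¹' (pt '' U ∪ {ultra F}) = U := by
          ext y
          simp
        rw [this]
        refine ⟨F.maximal.prop.isOpen U hU, fun G hG => ?_⟩
        obtain rfl : G = F := by simpa using hG
        exact hU
    | univ => exact ⟨isOpen_univ, fun F _ => F.maximal.prop.univ_mem⟩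
    | inter S T _ _ hS hT =>
      exact ⟨hS.1.inter hT.1,
        fun F hF => F.maximal.prop.inter_mem _ (hS.2 F hF.1) _ (hT.2 F hF.2)⟩
    | sUnion c _ hc =>
      have hopen : IsOpen (pt ⁻¹' ⋃₀ c) := by
        rw [preimage_sUnion]
        exact isOpen_biUnion fun S hS => (hc S hS).1
      refine ⟨hopen, ?_⟩
      rintro F ⟨S, hS, hFS⟩
      exact F.maximal.prop.mem_of_subset _ ((hc S hS).2 F hFS) _ hopen
        (preimage_mono (subset_sUnion_of_mem hS))
  · rintro ⟨hO, hF⟩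
    refine isOpen_iff_forall_mem_open.2 fun x hx => ?_
    cases x with
    | pt y =>
      exact ⟨pt '' (pt ⁻¹' O), image_preimage_subset _ _,
        .basic _ (Or.inl ⟨_, hO, rfl⟩), mem_image_of_mem _ hx⟩
    | ultra F =>
      refine ⟨pt '' (pt ⁻¹' O) ∪ {ultra F}, ?_, .basic _ (Or.inr ⟨F, _, hF F hx, rfl⟩), by simp⟩
      exact union_subset (image_preimage_subset _ _) (singleton_subset_iff.2 hx)

namespace StarSpace

variable (V : ℕ → FreeOpenUltrafilter Y)

/-- The inclusion of `Y` into `Y ∪ {V n : n < ω}`. -/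
def ofPt (y : Y) : StarSpace V := ⟨.pt y, Or.inl ⟨y, rfl⟩⟩

/-- The point `V n` of `Y ∪ {V n : n < ω}`. -/
def ofIdx (n : ℕ) : StarSpace V := ⟨.ultra (V n), Or.inr ⟨n, rfl⟩⟩

variable {V}

theorem eq_ofPt_or_ofIdx (x : StarSpace V) : (∃ y, x = ofPt V y) ∨ ∃ n, x = ofIdx V n := by
  rcases x with ⟨_, ⟨y, rfl⟩ | ⟨n, rfl⟩⟩
  · exact Or.inl ⟨y, rfl⟩
  · exact Or.inr ⟨n, rfl⟩

theorem ofPt_injective : Function.Injective (ofPt V) := fun a b h => by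
  cases congrArg Subtype.val h; rfl

theorem ofPt_ne_ofIdx (y : Y) (n : ℕ) : ofPt V y ≠ ofIdx V n := fun h => by
  cases congrArg Subtype.val h

theorem ofIdx_eq_iff {m n : ℕ} : ofIdx V m = ofIdx V n ↔ V m = V n := by
  constructor
  · intro h
    exact KatetovExtension.ultra.inj (congrArg Subtype.val h)
  · exact fun h => Subtype.ext (congrArg KatetovExtension.ultra h)

theorem isOpen_iff {O : Set (StarSpace V)} :
    IsOpen O ↔ IsOpen (ofPt V ⁻¹' O) ∧ ∀ n, ofIdx V n ∈ O → ofPt V ⁻¹' O ∈ (V n).sets := by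
  constructor
  · intro h
    obtain ⟨O', hO', rfl⟩ := isOpen_induced_iff.1 h
    rw [KatetovExtension.isOpen_iff] at hO'
    exact ⟨hO'.1, fun n hn => hO'.2 _ hn⟩
  · rintro ⟨hO, hV⟩
    have hpre : KatetovExtension.pt ⁻¹' (Subtype.val '' O) = ofPt V ⁻¹' O := by
      ext y
      simp [ofPt]
    -- The image of `O` is itself open in `κY`: its only ultrafilters are among the `V n`.
    refine isOpen_induced_iff.2 ⟨Subtype.val '' O, KatetovExtension.isOpen_iff.2 ?_,
      preimage_image_eq _ Subtype.val_injective⟩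
    rw [hpre]
    refine ⟨hO, ?_⟩
    rintro F ⟨x, hx, hxF⟩
    rcases eq_ofPt_or_ofIdx x with ⟨y, rfl⟩ | ⟨n, rfl⟩
    · cases hxF
    · cases hxF
      exact hV n hx

theorem isOpen_image_ofPt {U : Set Y} (hU : IsOpen U) : IsOpen (ofPt V '' U) := by
  rw [isOpen_iff, ofPt_injective.preimage_image]
  exact ⟨hU, fun n ⟨y, _, hy⟩ => absurd hy (ofPt_ne_ofIdx y n)⟩

theorem isOpen_insert_ofIdx {n : ℕ} {U : Set Y} (hU : U ∈ (V n).sets) :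
    IsOpen (insert (ofIdx V n) (ofPt V '' U)) := by
  have hpre : ofPt V ⁻¹' insert (ofIdx V n) (ofPt V '' U) = U := by
    ext y
    simp [ofPt_ne_ofIdx, ofPt_injective.eq_iff]
  rw [isOpen_iff, hpre]
  refine ⟨(V n).maximal.prop.isOpen U hU, ?_⟩
  rintro m (hm | ⟨y, -, hy⟩)
  · rwa [ofIdx_eq_iff.1 hm]
  · exact absurd hy (ofPt_ne_ofIdx y m)

theorem continuous_ofPt : Continuous (ofPt V) :=
  continuous_def.2 fun _ hO => (isOpen_iff.1 hO).1

theorem denseRange_ofPt : DenseRange (ofPt V) := by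
  refine dense_iff_inter_open.2 ?_
  rintro O hO ⟨x, hx⟩
  rcases eq_ofPt_or_ofIdx x with ⟨y, rfl⟩ | ⟨n, rfl⟩
  · exact ⟨_, hx, y, rfl⟩
  · obtain ⟨y, hy⟩ := (V n).nonempty_of_mem ((isOpen_iff.1 hO).2 n hx)
    exact ⟨_, hy, y, rfl⟩

theorem ofIdx_mem_closure_image_iff {n : ℕ} {U : Set Y} (hU : IsOpen U) :
    ofIdx V n ∈ closure (ofPt V '' U) ↔ U ∈ (V n).sets := by
  constructor
  · refine fun h => (V n).mem_of_forall_inter_nonempty hU fun W hW => ?_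
    obtain ⟨_, hz, y, hy, rfl⟩ := mem_closure_iff.1 h _ (isOpen_insert_ofIdx hW) (mem_insert _ _)
    refine ⟨y, hy, ?_⟩
    simpa [ofPt_ne_ofIdx, ofPt_injective.eq_iff] using hz
  · refine fun h => mem_closure_iff.2 fun O hO hn => ?_
    obtain ⟨y, hyU, hyO⟩ := (V n).nonempty_of_mem
      ((V n).maximal.prop.inter_mem U h _ ((isOpen_iff.1 hO).2 n hn))
    exact ⟨_, hyO, y, hyU, rfl⟩

theorem preimage_closure_image (U : Set Y) : ofPt V ⁻¹' closure (ofPt V '' U) = closure U := by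
  refine subset_antisymm (fun y hy => mem_closure_iff.2 fun O hO hyO => ?_)
    (image_subset_iff.1 (image_closure_subset_closure_image continuous_ofPt))
  obtain ⟨_, ⟨z, hz, rfl⟩, w, hw, hwz⟩ :=
    mem_closure_iff.1 hy _ (isOpen_image_ofPt hO) (mem_image_of_mem _ hyO)
  rw [ofPt_injective hwz] at hw
  exact ⟨z, hz, hw⟩

theorem t2Space [T2Space Y] : T2Space (StarSpace V) := by
  have mixed (y : Y) (n : ℕ) : ∃ A B : Set (StarSpace V),
      IsOpen A ∧ IsOpen B ∧ ofPt V y ∈ A ∧ ofIdx V n ∈ B ∧ Disjoint A B := by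
    obtain ⟨U, hU, hy⟩ := (V n).exists_notMem_closure y
    refine ⟨_, _, isOpen_image_ofPt isClosed_closure.isOpen_compl, isOpen_insert_ofIdx hU,
      mem_image_of_mem _ hy, mem_insert _ _, ?_⟩
    rw [disjoint_insert_right]
    refine ⟨fun ⟨z, _, hz⟩ => ofPt_ne_ofIdx z n hz, ?_⟩
    exact (disjoint_image_iff ofPt_injective).2
      (disjoint_compl_left.mono_right subset_closure)
  refine ⟨fun x x' hne => ?_⟩
  rcases eq_ofPt_or_ofIdx x with ⟨y, rfl⟩ | ⟨n, rfl⟩ <;>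
    rcases eq_ofPt_or_ofIdx x' with ⟨y', rfl⟩ | ⟨n', rfl⟩
  · obtain ⟨A, B, hA, hB, hyA, hyB, hAB⟩ := t2_separation (ne_of_apply_ne _ hne)
    exact ⟨_, _, isOpen_image_ofPt hA, isOpen_image_ofPt hB, mem_image_of_mem _ hyA,
      mem_image_of_mem _ hyB, (disjoint_image_iff ofPt_injective).2 hAB⟩
  · exact mixed y n'
  · obtain ⟨A, B, hA, hB, hyA, hnB, hAB⟩ := mixed y' n
    exact ⟨B, A, hB, hA, hnB, hyA, hAB.symm⟩
  · obtain ⟨U, hU, W, hW, hUW⟩ := FreeOpenUltrafilter.exists_disjoint_of_ne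
      (fun h => hne (ofIdx_eq_iff.2 h) : V n ≠ V n')
    refine ⟨_, _, isOpen_insert_ofIdx hU, isOpen_insert_ofIdx hW, mem_insert _ _,
      mem_insert _ _, ?_⟩
    rw [disjoint_insert_left, disjoint_insert_right]
    refine ⟨?_, fun ⟨z, _, hz⟩ => ofPt_ne_ofIdx z n' hz,
      (disjoint_image_iff ofPt_injective).2 hUW⟩
    rintro (h | ⟨z, _, hz⟩)
    · exact hne h
    · exact ofPt_ne_ofIdx z n hz

theorem extremallyDisconnected [ExtremallyDisconnected Y] :
    ExtremallyDisconnected (StarSpace V) := by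
  refine ⟨fun O hO => ?_⟩
  have hU : IsOpen (ofPt V ⁻¹' O) := hO.preimage continuous_ofPt
  -- By density of `Y`, `O` and its trace on `Y` have the same closure.
  have hcl : closure O = closure (ofPt V '' (ofPt V ⁻¹' O)) := by
    rw [image_preimage_eq_inter_range]
    refine subset_antisymm (closure_minimal ?_ isClosed_closure) (closure_mono inter_subset_left)
    exact Dense.open_subset_closure_inter denseRange_ofPt hO
  rw [hcl, isOpen_iff, preimage_closure_image]
  have hopen := ExtremallyDisconnected.open_closure _ hU
  refine ⟨hopen, fun n hn => ?_⟩
  exact (V n).maximal.prop.mem_of_subset _ ((ofIdx_mem_closure_image_iff hU).1 hn) _ hopen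
    subset_closure

theorem not_isOpen_singleton (hY : ∀ y : Y, ¬ IsOpen ({y} : Set Y)) (x : StarSpace V) :
    ¬ IsOpen ({x} : Set (StarSpace V)) := by
  intro h
  obtain ⟨_, rfl, y, rfl⟩ := denseRange_ofPt.inter_open_nonempty _ h (singleton_nonempty x)
  have := h.preimage continuous_ofPt
  rw [← image_singleton, ofPt_injective.preimage_image] at this
  exact hY y this

theorem countable [Countable Y] : Countable (StarSpace V) :=
  ((countable_range _).union (countable_range _)).to_subtype

theorem not_isSemiregular [Nonempty Y] (hV : IsOpenCovering V) :
    ¬ IsSemiregular (StarSpace V) := by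
  intro h
  obtain ⟨y⟩ := ‹Nonempty Y›
  obtain ⟨W, hW, hyW, hsub⟩ := h.exists_subset_of_mem_open
    (mem_image_of_mem (ofPt V) (mem_univ y)) (isOpen_image_ofPt isOpen_univ)
  have hWo : IsOpen W := by
    rw [← show interior (closure W) = W from hW]
    exact isOpen_interior
  have hU := hWo.preimage (continuous_ofPt (V := V))
  obtain ⟨n, hn⟩ := hV _ hU ⟨y, hyW⟩
  have himg : ofPt V '' (ofPt V ⁻¹' W) ⊆ W := image_preimage_subset _ _
  -- `V n` together with the trace of `W` is an open set inside `closure W`.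
  have hmem : ofIdx V n ∈ interior (closure W) := by
    refine mem_interior.2 ⟨_, insert_subset ?_ (himg.trans subset_closure),
      isOpen_insert_ofIdx hn, mem_insert _ _⟩
    exact closure_mono himg ((ofIdx_mem_closure_image_iff hU).2 hn)
  rw [show interior (closure W) = W from hW] at hmem
  obtain ⟨z, -, hz⟩ := hsub hmem
  exact ofPt_ne_ofIdx z n hz

end StarSpace

end Star

/-! ### Selective high divergence from extremal disconnectedness. -/

section SHD

variable {X : Type*} [TopologicalSpace X]

/-- The terms of an injective convergent sequence that omits its limit have pairwise disjoint
neighbourhoods. -/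
theorem exists_pairwise_disjoint_isOpen_of_tendsto [T2Space X] {x : ℕ → X} {a : X}
    (hx : Function.Injective x) (hne : ∀ n, x n ≠ a) (hlim : Tendsto x atTop (𝓝 a)) :
    ∃ O : ℕ → Set X, (∀ n, IsOpen (O n) ∧ x n ∈ O n) ∧ Pairwise (Function.onFun Disjoint O) := by
  have hsep (n : ℕ) : ∃ A B : Set X, IsOpen A ∧ IsOpen B ∧ x n ∈ A ∧
      (∀ m, m ≠ n → x m ∈ B) ∧ Disjoint A B := by
    -- Overwriting the `n`-th term by `a` keeps the limit and removes `x n`, so the other terms with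
    -- `a` form a compact set missing `x n`.
    have hy : Tendsto (Function.update x n a) atTop (𝓝 a) := by
      refine hlim.congr' ?_
      filter_upwards [eventually_ne_atTop n] with m hm
      rw [Function.update_of_ne hm]
    have hnot : x n ∉ insert a (range (Function.update x n a)) := by
      rintro (h | ⟨m, hm⟩)
      · exact hne n h
      · by_cases hmn : m = n
        · subst hmn
          rw [Function.update_self] at hm
          exact hne m hm.symm
        · rw [Function.update_of_ne hmn] at hm
          exact hmn (hx hm)
    obtain ⟨A, B, hA, hB, hxA, hKB, hAB⟩ := SeparatedNhds.of_isCompact_isCompact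
      (isCompact_singleton (x := x n)) hy.isCompact_insert_range
      (disjoint_singleton_left.2 hnot)
    refine ⟨A, B, hA, hB, hxA rfl, fun m hm => hKB (Or.inr ⟨m, ?_⟩), hAB⟩
    rw [Function.update_of_ne hm]
  choose A B hA hB hxA hxB hAB using hsep
  -- For `m < n`, `O m ⊆ A m` and `O n ⊆ B m`; only finitely many `B m` are intersected, so `O n` is
  -- open.
  refine ⟨fun n => A n ∩ ⋂ m ∈ Iio n, B m, fun n => ⟨?_, hxA n, ?_⟩, ?_⟩
  · exact (hA n).inter ((finite_Iio n).isOpen_biInter fun m _ => hB m)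
  · exact mem_iInter₂.2 fun m hm => hxB m n (ne_of_gt hm)
  · refine (pairwise_disjoint_on _).2 fun m n hmn => ?_
    exact (hAB m).mono inter_subset_left
      (inter_subset_right.trans (biInter_subset_of_mem (mem_Iio.2 hmn)))

/-- Separate a tail by disjoint open sets: the unions over even and odd indices would have disjoint
closures, yet both contain the limit. -/
theorem not_tendsto_of_injective [T2Space X] [ExtremallyDisconnected X] {x : ℕ → X}
    (hx : Function.Injective x) (a : X) : ¬ Tendsto x atTop (𝓝 a) := by
  intro hlim
  obtain ⟨N, hN⟩ : ∃ N, ∀ n ≥ N, x n ≠ a := by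
    by_cases h : ∃ k, x k = a
    · obtain ⟨k, hk⟩ := h
      exact ⟨k + 1, fun n hn hna => by have := hx (hna.trans hk.symm); omega⟩
    · exact ⟨0, fun n _ hn => h ⟨n, hn⟩⟩
  obtain ⟨O, hO, hdisj⟩ := exists_pairwise_disjoint_isOpen_of_tendsto (x := fun n => x (n + N))
    (fun m n h => by have := hx h; omega) (fun n => hN _ (by omega))
    (hlim.comp (tendsto_add_atTop_nat N))
  have hmem (f : ℕ → ℕ) (hf : StrictMono f) : a ∈ closure (⋃ n, O (f n)) :=
    mem_closure_of_tendsto ((hlim.comp (tendsto_add_atTop_nat N)).comp hf.tendsto_atTop)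
      (Eventually.of_forall fun n => mem_iUnion.2 ⟨n, (hO (f n)).2⟩)
  have hd : Disjoint (⋃ n, O (2 * n)) (⋃ n, O (2 * n + 1)) :=
    disjoint_iUnion_left.2 fun m => disjoint_iUnion_right.2 fun n => hdisj (by omega)
  exact (ExtremallyDisconnected.disjoint_closure_of_disjoint_isOpen hd
    (isOpen_iUnion fun n => (hO _).1) (isOpen_iUnion fun n => (hO _).1)).le_bot
    ⟨hmem _ fun m n h => by omega, hmem _ fun m n h => by omega⟩

theorem exists_injective_forall_mem {α : Type*} {U : ℕ → Set α} (hU : ∀ n, (U n).Infinite) :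
    ∃ x : ℕ → α, Function.Injective x ∧ ∀ n, x n ∈ U n := by
  classical
  have hex (n : ℕ) (s : Finset α) : ∃ y ∈ U n, y ∉ s := (hU n).exists_notMem_finset s
  choose g hgU hgs using hex
  -- `S n` collects the points chosen before stage `n`; the next choice avoids it.
  let S : ℕ → Finset α := fun n => Nat.rec ∅ (fun k s => insert (g k s) s) n
  have hS (n : ℕ) : S (n + 1) = insert (g n (S n)) (S n) := rfl
  have hmono : Monotone S := monotone_nat_of_le_succ fun n => by
    rw [hS]
    exact Finset.subset_insert _ _
  have hlt {m n : ℕ} (h : m < n) : g m (S m) ≠ g n (S n) := by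
    intro heq
    refine hgs n (S n) (heq ▸ hmono (Nat.succ_le_of_lt h) ?_)
    rw [Nat.succ_eq_add_one, hS]
    exact Finset.mem_insert_self _ _
  refine ⟨fun n => g n (S n), fun m n h => ?_, fun n => hgU n _⟩
  by_contra hmn
  rcases lt_or_gt_of_ne hmn with h' | h'
  · exact hlt h' h
  · exact hlt h' h.symm

theorem isSHD_of_extremallyDisconnected [T2Space X] [ExtremallyDisconnected X]
    (hX : ∀ x : X, ¬ IsOpen ({x} : Set X)) : IsSHD X := by
  intro U hU
  have hinf (n : ℕ) : (U n).Infinite := by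
    obtain ⟨hUo, y, hy⟩ := hU n
    have : (𝓝[≠] y).NeBot := ⟨fun h => hX y (isOpen_singleton_iff_punctured_nhds y |>.2 h)⟩
    exact infinite_of_mem_nhds y (hUo.mem_nhds hy)
  obtain ⟨x, hx, hxU⟩ := exists_injective_forall_mem hinf
  exact ⟨x, hxU, fun φ hφ a => not_tendsto_of_injective (hx.comp hφ.injective) a⟩

end SHD

theorem mainTheorem4 :
    (∃ u : ℚ → IliadisAbsolute ℚ, IsFibreSelection u) ∧
    ∀ u : ℚ → IliadisAbsolute ℚ, IsFibreSelection u →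
      (∃ V : ℕ → FreeOpenUltrafilter (SSpace u), IsOpenCovering V) ∧
      ∀ V : ℕ → FreeOpenUltrafilter (SSpace u), IsOpenCovering V →
        T2Space (StarSpace V) ∧
        ExtremallyDisconnected (StarSpace V) ∧
        (∀ x : StarSpace V, ¬ IsOpen ({x} : Set (StarSpace V))) ∧
        Countable (StarSpace V) ∧
        IsSHD (StarSpace V) ∧
        ¬ IsSemiregular (StarSpace V) := by
  refine ⟨exists_isFibreSelection ℚ, fun u hu => ⟨exists_isOpenCovering hu, fun V hV => ?_⟩⟩
  have : T2Space (SSpace u) := T2Space.of_injective_continuous (sProj_injective hu) continuous_sProj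
  have : ExtremallyDisconnected (SSpace u) := extremallyDisconnected_sSpace hu
  have : Countable (SSpace u) := (sProj_injective hu).countable
  have : Nonempty (SSpace u) := ⟨⟨u 0, 0, rfl⟩⟩
  have hT2 : T2Space (StarSpace V) := StarSpace.t2Space
  have hED : ExtremallyDisconnected (StarSpace V) := StarSpace.extremallyDisconnected
  have hiso : ∀ x : StarSpace V, ¬ IsOpen ({x} : Set (StarSpace V)) :=
    StarSpace.not_isOpen_singleton (not_isOpen_singleton_sSpace hu fun x => not_isOpen_singleton x)
  exact ⟨hT2, hED, hiso, StarSpace.countable, isSHD_of_extremallyDisconnected hiso,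
    StarSpace.not_isSemiregular hV⟩
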